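/- Let $N,m$ be integers with $2\le m\le N/2$, let $2^*=\frac{2N}{N-2}$, and write $x=(x^1,x^2,x^3)\in\mathbb{R}^N=\mathbb{R}^m\times\mathbb{R}^m\times\mathbb{R}^{N-2m}$. Let $\mathcal{D}^{1,2}(\mathbb{R}^N)$ be the completion of $\mathcal{C}_0^\infty(\mathbb{R}^N)$ (real-valued functions) with respect to the norm $\|u\|=\left(\int_{\mathbb{R}^N}|\nabla u|^2\,dx\right)^{1/2}$, regarded as a space of functions in $L^{2^*}(\mathbb{R}^N)$ by means of the Sobolev inequality, and let $\mathcal{D}^{1,2}_{\mathcal{O}_1}(\mathbb{R}^N)$ be the subspace of those $u$ that are invariant under $\mathcal{O}_1=\mathcal{O}(m)\times\mathcal{O}(m)\times\mathrm{id}\subset\mathcal{O}(N)$, i.e. for all $A,B\in\mathcal{O}(m)$ one has $u(Ax^1,Bx^2,x^3)=u(x^1,x^2,x^3)$ for almost every $x$. Suppose that $(u_n)\subset\mathcal{D}^{1,2}_{\mathcal{O}_1}(\mathbb{R}^N)$ is bounded and that $r_0>0$ is such that for all $r\ge r_0$ $$\lim_{n\to\infty}\ \sup_{z\in\mathbb{R}^{N-2m}}\int_{B((0,0,z),r)}|u_n|^2\,dx=0.$$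 Then for every continuous function $\Psi:\mathbb{R}\to[0,\infty)$ such that $$\lim_{s\to0}\frac{\Psi(s)}{|s|^{2^*}}=\lim_{|s|\to\infty}\frac{\Psi(s)}{|s|^{2^*}}=0,$$ each $\Psi(u_n)$ is integrable on $\mathbb{R}^N$, and $$\int_{\mathbb{R}^N}\Psi(u_n)\,dx\to0\quad\text{as }n\to\infty.$$ -/

import Mathlib

open MeasureTheory Filter Topology
open scoped ContDiff ENNReal

noncomputable section

/-- The critical Sobolev exponent `2^* = 2N/(N-2)`. -/
def twoStar (N : ℕ) : ℝ := 2 * (N : ℝ) / ((N : ℝ) - 2)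

/-- Test functions: smooth, compactly supported, real valued. -/
def IsTestFunction {ι : Type*} [Fintype ι] (φ : EuclideanSpace ℝ ι → ℝ) : Prop :=
  ContDiff ℝ ∞ φ ∧ HasCompactSupport φ

/-- `V` is the gradient of the element `u` of `D^{1,2}(ℝ^N)`, `N = card ι ≥ 3`. The space
`D^{1,2}(ℝ^N)` is the completion of the test functions for the norm `‖∇φ‖_{L²}`; by the
Sobolev inequality a Cauchy sequence for this norm converges in `L^{2^*}`, and the completion is
the space of functions obtained as such limits `u`. The gradient of `u` is the `L²` limit `V` of
the gradients; it is determined by `u` up to equality almost everywhere. -/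
def IsD12Gradient {ι : Type*} [Fintype ι] (u : EuclideanSpace ℝ ι → ℝ)
    (V : EuclideanSpace ℝ ι → EuclideanSpace ℝ ι) : Prop :=
  MemLp u (ENNReal.ofReal (twoStar (Fintype.card ι))) volume ∧
  MemLp V 2 volume ∧
  ∃ φ : ℕ → EuclideanSpace ℝ ι → ℝ,
    (∀ k, IsTestFunction (φ k)) ∧
    Tendsto (fun k => eLpNorm (fun x => φ k x - u x)
      (ENNReal.ofReal (twoStar (Fintype.card ι))) volume) atTop (𝓝 0) ∧
    Tendsto (fun k => eLpNorm (fun x => gradient (φ k) x - V x) 2 volume) atTop (𝓝 0)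

/-- `u ∈ D^{1,2}(ℝ^N)`, where `N = card ι`. -/
def MemD12 {ι : Type*} [Fintype ι] (u : EuclideanSpace ℝ ι → ℝ) : Prop :=
  ∃ V : EuclideanSpace ℝ ι → EuclideanSpace ℝ ι, IsD12Gradient u V

open Classical in
/-- The gradient of `u ∈ D^{1,2}(ℝ^N)` (zero if `u` is not in the space). -/
def d12Gradient {ι : Type*} [Fintype ι] (u : EuclideanSpace ℝ ι → ℝ) :
    EuclideanSpace ℝ ι → EuclideanSpace ℝ ι :=
  if h : MemD12 u then h.choose else 0

/-- The norm `(∫ |∇u|²)^{1/2}` of `D^{1,2}(ℝ^N)`. -/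
def d12Norm {ι : Type*} [Fintype ι] (u : EuclideanSpace ℝ ι → ℝ) : ℝ :=
  Real.sqrt (∫ x, ‖d12Gradient u x‖ ^ 2)

/-- `ℝ^N = ℝ^m × ℝ^m × ℝ^{N-2m}` with the Euclidean norm and Lebesgue measure (for `2m ≤ N`). -/
abbrev SplitSpace (N m : ℕ) : Type := EuclideanSpace ℝ (Fin m ⊕ Fin m ⊕ Fin (N - 2 * m))

/-- The point `(x₁, x₂, x₃)` of `ℝ^m × ℝ^m × ℝ^{N-2m}`. -/
def splitPoint {N m : ℕ} (x₁ x₂ : Fin m → ℝ) (x₃ : Fin (N - 2 * m) → ℝ) : SplitSpace N m :=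
  WithLp.toLp 2 (Sum.elim x₁ (Sum.elim x₂ x₃))

/-- The action `(x₁, x₂, x₃) ↦ (A x₁, B x₂, x₃)`. -/
def blockAct {N m : ℕ} (A B : Matrix (Fin m) (Fin m) ℝ) (x : SplitSpace N m) : SplitSpace N m :=
  splitPoint (A.mulVec fun i => x (Sum.inl i)) (B.mulVec fun i => x (Sum.inr (Sum.inl i)))
    (fun i => x (Sum.inr (Sum.inr i)))

/-- Invariance of (the a.e. class of) `u` under `O(m) × O(m) × id`. -/
def IsO1Invariant {N m : ℕ} (u : SplitSpace N m → ℝ) : Prop :=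
  ∀ A ∈ Matrix.orthogonalGroup (Fin m) ℝ, ∀ B ∈ Matrix.orthogonalGroup (Fin m) ℝ,
    ∀ᵐ x, u (blockAct A B x) = u x

/-- `Ψ(s)/|s|^{2^*} → 0` both as `s → 0` and as `|s| → ∞`. -/
def IsSubcritical (N : ℕ) (Ψ : ℝ → ℝ) : Prop :=
  Tendsto (fun s : ℝ => Ψ s / |s| ^ twoStar N) (𝓝[≠] 0) (𝓝 0) ∧
  Tendsto (fun s : ℝ => Ψ s / |s| ^ twoStar N) (comap (fun s : ℝ => |s|) atTop) (𝓝 0)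

end

open scoped NNReal

/-! For every `ε > 0` there are `a > 0` and `K` with `Ψ(s) ≤ ε|s|^{2^*} + K·1_{|s| ≥ a}`
(`IsSubcritical.exists_le`). Since `(u_n)` is bounded in `L^{2^*}` by Sobolev, it suffices that
`|{|u_n| ≥ a}| → 0` for each `a > 0`.

This follows from a quantitative Lions-type lemma (`IsD12Gradient.mul_measure_le`). If `u` is small
in `L²` on every ball of radius `δ`, then at a point where `|u| ≥ a` the mean of `|u(x+h) - u(x)|²`
over `|h| < δ` is at least `a²/4`. As `‖u(·+h) - u‖₂ ≤ |h| ‖∇u‖₂`, this gives `a² |{|u| ≥ a}| ≤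
4δ²‖∇u‖₂²`, and `δ` is arbitrary.

Smallness on all balls comes from symmetry (`eventually_setLIntegral_ball_le`). A ball centred near
the fixed space `{(0,0,z)}` lies in a larger ball centred on it, where the hypothesis applies. For a
centre far from that space, the orbit contains `k` points with disjoint balls around them, all
carrying the same mass, so each has at most `1/k` of the `L^{2^*}` mass; Hölder's inequality
concludes. -/

/-! ### Translation estimates for `C¹` functions -/

theorem enorm_gradient {E : Type*} [NormedAddCommGroup E] [InnerProductSpace ℝ E] [CompleteSpace E]
    (f : E → ℝ) (x : E) : ‖gradient f x‖ₑ = ‖fderiv ℝ f x‖ₑ := by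
  rw [gradient, LinearIsometryEquiv.enorm_map]

theorem eLpNorm_gradient {E : Type*} [NormedAddCommGroup E] [InnerProductSpace ℝ E]
    [CompleteSpace E] [MeasurableSpace E] (f : E → ℝ) (p : ℝ≥0∞) (μ : Measure E) :
    eLpNorm (gradient f) p μ = eLpNorm (fderiv ℝ f) p μ :=
  eLpNorm_congr_enorm_ae (ae_of_all _ fun x => enorm_gradient f x)

theorem eLpNorm_two_sq {α E : Type*} [MeasurableSpace α] [NormedAddCommGroup E] (f : α → E)
    (μ : Measure α) : eLpNorm f 2 μ ^ 2 = ∫⁻ x, ‖f x‖ₑ ^ 2 ∂μ := by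
  rw [eLpNorm_eq_lintegral_rpow_enorm_toReal (by norm_num) (by norm_num), ← ENNReal.rpow_natCast,
    ← ENNReal.rpow_mul]
  norm_num

/-- Fundamental theorem of calculus on the segment from `x` to `x + h`, then Cauchy–Schwarz in `t`
on the probability space `(0,1]`. -/
theorem enorm_translate_sub_sq_le {E : Type*} [NormedAddCommGroup E] [NormedSpace ℝ E]
    {φ : E → ℝ} (hφ : ContDiff ℝ 1 φ) (x h : E) :
    ‖φ (x + h) - φ x‖ₑ ^ 2 ≤
      ‖h‖ₑ ^ 2 * ∫⁻ t in Set.Ioc (0 : ℝ) 1, ‖fderiv ℝ φ (x + t • h)‖ₑ ^ 2 := by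
  have hd : Continuous (fun t : ℝ => fderiv ℝ φ (x + t • h)) :=
    (hφ.continuous_fderiv one_ne_zero).comp (by fun_prop)
  have hderiv : ∀ t : ℝ, HasDerivAt (fun t : ℝ => φ (x + t • h)) (fderiv ℝ φ (x + t • h) h) t := by
    intro t
    have h1 : HasDerivAt (fun t : ℝ => x + t • h) h t := by
      simpa using ((hasDerivAt_id t).smul_const h).const_add x
    exact ((hφ.differentiable one_ne_zero) _).hasFDerivAt.comp_hasDerivAt t h1
  have hint := intervalIntegral.integral_eq_sub_of_hasDerivAt (a := 0) (b := 1)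
    (fun t _ => hderiv t) ((hd.clm_apply continuous_const).intervalIntegrable 0 1)
  rw [intervalIntegral.integral_of_le zero_le_one] at hint
  simp only [one_smul, zero_smul, add_zero] at hint
  rw [← hint]
  have : IsProbabilityMeasure (volume.restrict (Set.Ioc (0 : ℝ) 1)) := ⟨by simp⟩
  have h1 : ‖∫ t in Set.Ioc (0 : ℝ) 1, fderiv ℝ φ (x + t • h) h‖ₑ ≤
      eLpNorm (fun t : ℝ => fderiv ℝ φ (x + t • h) h) 2 (volume.restrict (Set.Ioc (0 : ℝ) 1)) := by
    refine (enorm_integral_le_lintegral_enorm _).trans ?_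
    rw [← eLpNorm_one_eq_lintegral_enorm]
    exact eLpNorm_le_eLpNorm_of_exponent_le (by norm_num)
      (hd.clm_apply continuous_const).aestronglyMeasurable
  calc _ ≤ _ := pow_le_pow_left' h1 2
    _ = ∫⁻ t in Set.Ioc (0 : ℝ) 1, ‖fderiv ℝ φ (x + t • h) h‖ₑ ^ 2 := eLpNorm_two_sq _ _
    _ ≤ ∫⁻ t in Set.Ioc (0 : ℝ) 1, ‖h‖ₑ ^ 2 * ‖fderiv ℝ φ (x + t • h)‖ₑ ^ 2 := by
      refine lintegral_mono fun t => ?_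
      rw [← mul_pow, mul_comm]
      exact pow_le_pow_left' (ContinuousLinearMap.le_opENorm _ _) 2
    _ = _ := lintegral_const_mul' _ _ (by finiteness)

/-- Integrating the pointwise bound in `x`, Tonelli and translation invariance make the integral
over `t` constant. -/
theorem eLpNorm_translate_sub_le {E : Type*} [NormedAddCommGroup E] [NormedSpace ℝ E]
    [FiniteDimensional ℝ E] [MeasurableSpace E] [BorelSpace E] (μ : Measure E) [μ.IsAddHaarMeasure]
    {φ : E → ℝ} (hφ : ContDiff ℝ 1 φ) (h : E) :
    eLpNorm (fun x => φ (x + h) - φ x) 2 μ ≤ ‖h‖ₑ * eLpNorm (fderiv ℝ φ) 2 μ := by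
  rw [← ENNReal.pow_le_pow_left_iff two_ne_zero, mul_pow, eLpNorm_two_sq, eLpNorm_two_sq]
  have hc := hφ.continuous_fderiv one_ne_zero
  calc _ ≤ ∫⁻ x, ‖h‖ₑ ^ 2 * (∫⁻ t in Set.Ioc (0 : ℝ) 1, ‖fderiv ℝ φ (x + t • h)‖ₑ ^ 2) ∂μ :=
        lintegral_mono fun x => enorm_translate_sub_sq_le hφ x h
    _ = ‖h‖ₑ ^ 2 * ∫⁻ x, (∫⁻ t in Set.Ioc (0 : ℝ) 1, ‖fderiv ℝ φ (x + t • h)‖ₑ ^ 2) ∂μ :=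
        lintegral_const_mul' _ _ (by finiteness)
    _ = ‖h‖ₑ ^ 2 * ∫⁻ t in Set.Ioc (0 : ℝ) 1, (∫⁻ x, ‖fderiv ℝ φ (x + t • h)‖ₑ ^ 2 ∂μ) := by
        rw [lintegral_lintegral_swap]
        refine Continuous.aemeasurable ?_
        refine (ENNReal.continuous_pow 2).comp (continuous_enorm.comp (hc.comp ?_))
        fun_prop
    _ = ‖h‖ₑ ^ 2 * ∫⁻ x, ‖fderiv ℝ φ x‖ₑ ^ 2 ∂μ := by
        congr 1
        simp_rw [lintegral_add_right_eq_self (μ := μ) (fun x => ‖fderiv ℝ φ x‖ₑ ^ 2)]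
        simp

theorem two_lt_twoStar {N : ℕ} (hN : 3 ≤ N) : 2 < twoStar N := by
  have : (3 : ℝ) ≤ N := by exact_mod_cast hN
  rw [twoStar, lt_div_iff₀ (by linarith)]
  linarith

/-! ### Estimates in `D^{1,2}` -/

section D12
variable {ι : Type*} [Fintype ι] {u : EuclideanSpace ℝ ι → ℝ}
  {V : EuclideanSpace ℝ ι → EuclideanSpace ℝ ι}

/-- Lower semicontinuity along the approximation by test functions: a bound of a seminorm of `T φ`
by the gradient of `φ` passes to the completion, if `T` respects convergence almost everywhere
along sequences. -/
theorem IsD12Gradient.eLpNorm_le (hN : 3 ≤ Fintype.card ι) (hu : IsD12Gradient u V)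
    (T : (EuclideanSpace ℝ ι → ℝ) → EuclideanSpace ℝ ι → ℝ)
    (hTmeas : ∀ φ, IsTestFunction φ → AEStronglyMeasurable (T φ) volume)
    (hTlim : ∀ φ : ℕ → EuclideanSpace ℝ ι → ℝ,
      (∀ᵐ x, Tendsto (fun k => φ k x) atTop (𝓝 (u x))) →
      ∀ᵐ x, Tendsto (fun k => T (φ k) x) atTop (𝓝 (T u x)))
    {p C : ℝ≥0∞} (hC : C ≠ ⊤)
    (hT : ∀ φ, IsTestFunction φ → eLpNorm (T φ) p volume ≤ C * eLpNorm (gradient φ) 2 volume) :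
    eLpNorm (T u) p volume ≤ C * eLpNorm V 2 volume := by
  obtain ⟨hup, hV, φ, hφ, hlim, hglim⟩ := hu
  have hp0 : ENNReal.ofReal (twoStar (Fintype.card ι)) ≠ 0 := by
    have := two_lt_twoStar hN
    simp only [ne_eq, ENNReal.ofReal_eq_zero, not_le]; linarith
  -- `L^{2^*}` convergence gives a.e. convergence along a subsequence, which is what Fatou's lemma
  -- needs below.
  obtain ⟨ns, hns, hae⟩ := (tendstoInMeasure_of_tendsto_eLpNorm (μ := volume) hp0
    (fun k => (hφ k).1.continuous.aestronglyMeasurable) hup.aestronglyMeasurable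
    hlim).exists_seq_tendsto_ae
  have hgrad : ∀ k, eLpNorm (gradient (φ k)) 2 volume ≤
      eLpNorm (fun x => gradient (φ k) x - V x) 2 volume + eLpNorm V 2 volume := by
    intro k
    have hc : Continuous (gradient (φ k)) :=
      (LinearIsometryEquiv.continuous _).comp ((hφ k).1.continuous_fderiv (by simp))
    refine le_trans (le_of_eq ?_) (eLpNorm_add_le (hc.aestronglyMeasurable.sub
      hV.aestronglyMeasurable) hV.aestronglyMeasurable (by norm_num))
    congr 1; ext x : 1; simp
  have hrhs : Tendsto (fun k => C * (eLpNorm (fun x => gradient (φ (ns k)) x - V x) 2 volume +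
      eLpNorm V 2 volume)) atTop (𝓝 (C * eLpNorm V 2 volume)) := by
    refine ENNReal.Tendsto.const_mul ?_ (Or.inr hC)
    simpa using (hglim.comp hns.tendsto_atTop).add (tendsto_const_nhds (x := eLpNorm V 2 volume))
  refine (Lp.eLpNorm_lim_le_liminf_eLpNorm (fun k => hTmeas _ (hφ (ns k))) _
    (hTlim _ hae)).trans ?_
  rw [← hrhs.liminf_eq]
  exact liminf_le_liminf (Eventually.of_forall fun k => (hT _ (hφ _)).trans
    (mul_le_mul_right (hgrad _) _))

/-- Passage to the limit from test functions; `u` itself need not lie in `L²`, only its increments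
do. -/
theorem IsD12Gradient.eLpNorm_translate_sub_le (hN : 3 ≤ Fintype.card ι) (hu : IsD12Gradient u V)
    (h : EuclideanSpace ℝ ι) :
    eLpNorm (fun x => u (x + h) - u x) 2 volume ≤ ‖h‖ₑ * eLpNorm V 2 volume := by
  refine hu.eLpNorm_le hN (fun φ x => φ (x + h) - φ x) ?_ ?_ (by finiteness) ?_
  · intro φ hφ
    have := hφ.1.continuous
    exact Continuous.aestronglyMeasurable (by fun_prop)
  · intro φ hφ
    have h2 := (measurePreserving_add_right volume h).quasiMeasurePreserving.ae hφ
    filter_upwards [hφ, h2] with x h1 h2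
    exact h2.sub h1
  · intro φ hφ
    rw [eLpNorm_gradient]
    exact _root_.eLpNorm_translate_sub_le _ (hφ.1.of_le (by simp)) h

theorem exists_sobolev_const (ι : Type*) [Fintype ι] (hN : 3 ≤ Fintype.card ι) :
    ∃ C : ℝ≥0, ∀ (u : EuclideanSpace ℝ ι → ℝ) (V : EuclideanSpace ℝ ι → EuclideanSpace ℝ ι),
      IsD12Gradient u V →
      eLpNorm u (ENNReal.ofReal (twoStar (Fintype.card ι))) volume ≤ C * eLpNorm V 2 volume := by
  refine ⟨SNormLESNormFDerivOfEqConst ℝ (volume : Measure (EuclideanSpace ℝ ι)) 2,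
    fun u V hu => ?_⟩
  refine hu.eLpNorm_le hN (fun φ => φ) (fun φ hφ => hφ.1.continuous.aestronglyMeasurable)
    (fun φ h => h) (by finiteness) fun φ hφ => ?_
  rw [eLpNorm_gradient]
  refine eLpNorm_le_eLpNorm_fderiv_of_eq volume (p := 2)
    (p' := Real.toNNReal (twoStar (Fintype.card ι))) (hφ.1.of_le (by simp)) hφ.2 (by norm_num)
    (by simp; omega) ?_
  have h2 := two_lt_twoStar hN
  have h3 : (3 : ℝ) ≤ Fintype.card ι := by exact_mod_cast hN
  rw [Real.coe_toNNReal _ (by linarith), finrank_euclideanSpace, twoStar]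
  have : (Fintype.card ι : ℝ) - 2 ≠ 0 := by linarith
  push_cast
  field_simp

/-- A function of `D^{1,2}` which is small in `L²` on all balls of radius `δ` can be large only on
a small set. -/
theorem IsD12Gradient.mul_measure_le (hN : 3 ≤ Fintype.card ι) (hu : IsD12Gradient u V)
    {a : ℝ≥0∞} {δ : ℝ}
    (hsmall : ∀ x, 4 * ∫⁻ y in Metric.ball x δ, ‖u y‖ₑ ^ 2 ≤
      a ^ 2 * volume (Metric.ball (0 : EuclideanSpace ℝ ι) δ))
    (ha : a ≠ ⊤) (hδ : 0 < δ) :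
    a ^ 2 * volume {x | a ≤ ‖u x‖ₑ} ≤ 4 * (ENNReal.ofReal δ ^ 2 * ∫⁻ x, ‖V x‖ₑ ^ 2) := by
  set B := Metric.ball (0 : EuclideanSpace ℝ ι) δ with hB
  have hum := hu.1.aestronglyMeasurable
  have hfin : ∀ c : ℝ≥0∞, c ≠ ⊤ → c * volume B ≠ ⊤ := fun c hc =>
    ENNReal.mul_ne_top hc measure_ball_lt_top.ne
  have hB0 : volume B ≠ 0 := (Metric.measure_ball_pos _ _ hδ).ne'
  have hum1 : ∀ x, AEMeasurable (fun h => ‖u (x + h)‖ₑ ^ 2) volume := fun x =>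
    ((hum.comp_measurePreserving (measurePreserving_add_left volume x)).enorm).pow_const 2
  have hprod : AEMeasurable (fun q : EuclideanSpace ℝ ι × EuclideanSpace ℝ ι =>
      ‖u (q.1 + q.2) - u q.1‖ₑ ^ 2) (volume.prod (volume.restrict B)) := by
    have h1 : AEStronglyMeasurable (fun q : EuclideanSpace ℝ ι × EuclideanSpace ℝ ι =>
        u (q.1 + q.2)) (volume.prod (volume.restrict B)) := by
      refine hum.comp_quasiMeasurePreserving ((quasiMeasurePreserving_add volume volume).mono_left ?_)
      exact Measure.AbsolutelyContinuous.prod Measure.AbsolutelyContinuous.rfl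
        Measure.absolutelyContinuous_restrict
    have h2 : AEStronglyMeasurable (fun q : EuclideanSpace ℝ ι × EuclideanSpace ℝ ι =>
        u q.1) (volume.prod (volume.restrict B)) := hum.comp_fst
    exact ((h1.sub h2).enorm).pow_const 2
  -- at a point where `|u|` is large, `u` differs from most of its translates
  have key : ∀ x, a ≤ ‖u x‖ₑ →
      a ^ 2 * volume B ≤ 4 * ∫⁻ h in B, ‖u (x + h) - u x‖ₑ ^ 2 := by
    intro x hx
    have hloc : ∫⁻ h in B, ‖u (x + h)‖ₑ ^ 2 = ∫⁻ y in Metric.ball x δ, ‖u y‖ₑ ^ 2 := by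
      have := (measurePreserving_add_left volume x).setLIntegral_comp_preimage_emb
        (MeasurableEquiv.addLeft x).measurableEmbedding (fun y => ‖u y‖ₑ ^ 2) (Metric.ball x δ)
      rw [← this]
      congr 2
      ext y; simp [hB]
    have hpt : ∀ h, a ^ 2 ≤ 2 * ‖u (x + h) - u x‖ₑ ^ 2 + 2 * ‖u (x + h)‖ₑ ^ 2 := by
      intro h
      refine (pow_le_pow_left' hx 2).trans ?_
      have : ‖u x‖ ^ 2 ≤ 2 * ‖u (x + h) - u x‖ ^ 2 + 2 * ‖u (x + h)‖ ^ 2 := by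
        simp only [Real.norm_eq_abs, sq_abs]
        nlinarith [sq_nonneg (u (x + h) - u x + u (x + h))]
      have h' := ENNReal.ofReal_le_ofReal this
      rw [ENNReal.ofReal_add (by positivity) (by positivity), ENNReal.ofReal_mul (by norm_num),
        ENNReal.ofReal_mul (by norm_num), ENNReal.ofReal_pow (by positivity),
        ENNReal.ofReal_pow (by positivity), ENNReal.ofReal_pow (by positivity)] at h'
      simpa only [ofReal_norm, ENNReal.ofReal_ofNat] using h'
    have h1 : a ^ 2 * volume B ≤ 2 * (∫⁻ h in B, ‖u (x + h) - u x‖ₑ ^ 2) +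
        2 * ∫⁻ y in Metric.ball x δ, ‖u y‖ₑ ^ 2 := by
      rw [← hloc, ← lintegral_const_mul' _ _ (by norm_num), ← lintegral_const_mul' _ _ (by norm_num),
        ← lintegral_add_right' _ ((hum1 x).restrict.const_mul 2), ← setLIntegral_const]
      exact lintegral_mono fun h => hpt h
    -- After doubling, `hsmall` bounds the local term by half of the left side, which is finite and
    -- can be subtracted.
    have h2 : 2 * (a ^ 2 * volume B) ≤ 4 * (∫⁻ h in B, ‖u (x + h) - u x‖ₑ ^ 2) +
        a ^ 2 * volume B := by
      calc _ ≤ 2 * (2 * (∫⁻ h in B, ‖u (x + h) - u x‖ₑ ^ 2) +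
            2 * ∫⁻ y in Metric.ball x δ, ‖u y‖ₑ ^ 2) := mul_le_mul_right h1 2
        _ = 4 * (∫⁻ h in B, ‖u (x + h) - u x‖ₑ ^ 2) +
            4 * ∫⁻ y in Metric.ball x δ, ‖u y‖ₑ ^ 2 := by ring
        _ ≤ _ := add_le_add le_rfl (hsmall x)
    rw [two_mul] at h2
    exact (ENNReal.add_le_add_iff_right (hfin _ (by finiteness))).1 h2
  have hmeas : AEMeasurable (fun x => ∫⁻ h in B, ‖u (x + h) - u x‖ₑ ^ 2) volume :=
    hprod.lintegral_prod_right'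
  have hcheb : a ^ 2 * volume B * volume {x | a ≤ ‖u x‖ₑ} ≤
      4 * ∫⁻ x, ∫⁻ h in B, ‖u (x + h) - u x‖ₑ ^ 2 := by
    rw [← lintegral_const_mul' _ _ (by norm_num)]
    refine le_trans ?_ (mul_meas_ge_le_lintegral₀ (hmeas.const_mul 4) (a ^ 2 * volume B))
    exact mul_le_mul_right (measure_mono fun x hx => key x hx) _
  -- Tonelli puts the `x` integral inside, where the translation estimate applies with `|h| < δ`.
  have htot : ∫⁻ x, ∫⁻ h in B, ‖u (x + h) - u x‖ₑ ^ 2 ≤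
      ENNReal.ofReal δ ^ 2 * (∫⁻ x, ‖V x‖ₑ ^ 2) * volume B := by
    rw [lintegral_lintegral_swap hprod, ← setLIntegral_const]
    refine setLIntegral_mono' Metric.isOpen_ball.measurableSet fun h hh => ?_
    rw [← eLpNorm_two_sq, ← eLpNorm_two_sq, ← mul_pow]
    refine pow_le_pow_left' ((hu.eLpNorm_translate_sub_le hN h).trans ?_) 2
    gcongr
    rw [← ofReal_norm]
    exact ENNReal.ofReal_le_ofReal (mem_ball_zero_iff.1 hh).le
  have := hcheb.trans (mul_le_mul_right htot 4)
  rw [← ENNReal.mul_le_mul_iff_left hB0 measure_ball_lt_top.ne]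
  calc _ = a ^ 2 * volume B * volume {x | a ≤ ‖u x‖ₑ} := by ring
    _ ≤ _ := this
    _ = _ := by ring

end D12

/-! ### Orbits of `O(m) × O(m) × id` and local smallness -/

theorem card_mul_setLIntegral_ball_le {E κ : Type*} [NormedAddCommGroup E] [InnerProductSpace ℝ E]
    [FiniteDimensional ℝ E] [MeasurableSpace E] [BorelSpace E] [Fintype κ]
    (g : κ → E ≃ₗᵢ[ℝ] E) {f : E → ℝ≥0∞} (hf : ∀ l, ∀ᵐ x, f (g l x) = f x) {y : E} {r : ℝ}
    (hsep : ∀ l l', l ≠ l' → 2 * r ≤ dist (g l y) (g l' y)) :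
    Fintype.card κ * ∫⁻ x in Metric.ball y r, f x ≤ ∫⁻ x, f x := by
  have heq : ∀ l, ∫⁻ x in Metric.ball y r, f x = ∫⁻ x in Metric.ball (g l y) r, f x := by
    intro l
    have h1 := (g l).measurePreserving.setLIntegral_comp_preimage_emb
      (g l).toHomeomorph.measurableEmbedding f (Metric.ball (g l y) r)
    rw [(g l).preimage_ball, LinearIsometryEquiv.symm_apply_apply] at h1
    rw [← h1]
    exact lintegral_congr_ae (ae_restrict_of_ae ((hf l).mono fun x hx => hx.symm))
  have hdisj : Pairwise (Function.onFun Disjoint fun l => Metric.ball (g l y) r) := by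
    intro l l' hl
    exact Metric.ball_disjoint_ball (by linarith [hsep l l' hl])
  calc (Fintype.card κ : ℝ≥0∞) * ∫⁻ x in Metric.ball y r, f x
      = ∑ l, ∫⁻ x in Metric.ball (g l y) r, f x := by
        simp_rw [← heq]; simp
    _ = ∫⁻ x in ⋃ l, Metric.ball (g l y) r, f x := by
        rw [lintegral_iUnion (fun l => measurableSet_ball) hdisj, tsum_fintype]
    _ ≤ _ := setLIntegral_le_lintegral _ _

/-- For `m ≥ 2` the unit sphere is connected with more than one point, hence infinite; finitely many
distinct points have a positive minimal distance. -/
theorem exists_separated_unit_vectors {m : ℕ} (hm : 2 ≤ m) (k : ℕ) :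
    ∃ d : ℝ, 0 < d ∧ ∃ e : Fin k → EuclideanSpace ℝ (Fin m), (∀ l, ‖e l‖ = 1) ∧
      ∀ l l', l ≠ l' → d ≤ dist (e l) (e l') := by
  have hrank : 1 < Module.rank ℝ (EuclideanSpace ℝ (Fin m)) := by
    rw [← Module.finrank_eq_rank, finrank_euclideanSpace_fin]
    exact_mod_cast hm
  have hinf : (Metric.sphere (0 : EuclideanSpace ℝ (Fin m)) 1).Infinite := by
    refine (isPreconnected_sphere hrank 0 1).infinite_of_nontrivial ?_
    set v : EuclideanSpace ℝ (Fin m) := EuclideanSpace.single ⟨0, by omega⟩ 1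
    have hv : ‖v‖ = 1 := by simp [v]
    refine ⟨v, by simp [hv], -v, by simp [hv], fun h => ?_⟩
    have h0 := congrArg (fun w => w.ofLp ⟨0, by omega⟩) h
    simp only [v, WithLp.ofLp_neg, Pi.neg_apply, EuclideanSpace.single, PiLp.single_apply, if_true] at h0
    linarith
  set e := hinf.natEmbedding
  have hev : ∀ᶠ d in 𝓝[>] (0 : ℝ), ∀ l l' : Fin k, l ≠ l' →
      d ≤ dist (e l : EuclideanSpace ℝ (Fin m)) (e l') := by
    simp only [eventually_all]
    intro l l' hl
    have hpos : 0 < dist (e l : EuclideanSpace ℝ (Fin m)) (e l') := by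
      refine dist_pos.2 fun h => hl ?_
      exact Fin.ext (e.injective (Subtype.ext h))
    filter_upwards [Ioo_mem_nhdsGT hpos] with d hd using hd.2.le
  obtain ⟨d, hd, hd0⟩ := (hev.and self_mem_nhdsWithin).exists
  exact ⟨d, hd0, fun l => e l, fun l => by simp, hd⟩

/-- The reflection in the hyperplane orthogonal to `x - y` sends `x` to `y`; it is the identity if
`x = y`. -/
theorem exists_orthogonal_mulVec_eq {ι : Type*} [Fintype ι] [DecidableEq ι]
    {x y : EuclideanSpace ℝ ι} (h : ‖x‖ = ‖y‖) :
    ∃ A ∈ Matrix.orthogonalGroup ι ℝ, A.mulVec x.ofLp = y.ofLp := by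
  set ρ := (ℝ ∙ (x - y))ᗮ.reflection
  refine ⟨_, ρ.toMatrix_mem_unitaryGroup (EuclideanSpace.basisFun ι ℝ)
    (EuclideanSpace.basisFun ι ℝ), ?_⟩
  have := LinearMap.toMatrix_mulVec_repr (EuclideanSpace.basisFun ι ℝ).toBasis
    (EuclideanSpace.basisFun ι ℝ).toBasis ρ.toLinearEquiv.toLinearMap x
  have hρ : ρ x = y := Submodule.reflection_sub h
  have hr : ∀ z, ⇑((EuclideanSpace.basisFun ι ℝ).toBasis.repr z) = z.ofLp := fun z => by
    ext i; simp [OrthonormalBasis.coe_toBasis_repr_apply]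
  rw [hr, hr] at this
  exact this.trans (congrArg _ hρ)

section Split
variable {N m : ℕ}

theorem norm_splitPoint_sq (a b : Fin m → ℝ) (c : Fin (N - 2 * m) → ℝ) :
    ‖(splitPoint a b c : SplitSpace N m)‖ ^ 2 =
      ‖WithLp.toLp 2 a‖ ^ 2 + (‖WithLp.toLp 2 b‖ ^ 2 + ‖WithLp.toLp 2 c‖ ^ 2) := by
  simp [EuclideanSpace.norm_sq_eq, splitPoint]

theorem splitPoint_sub (a b a' b' : Fin m → ℝ) (c c' : Fin (N - 2 * m) → ℝ) :
    (splitPoint a b c : SplitSpace N m) - splitPoint a' b' c' =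
      splitPoint (a - a') (b - b') (c - c') := by
  ext i; rcases i with i | i | i <;> simp [splitPoint]

theorem splitPoint_eta (x : SplitSpace N m) :
    splitPoint (fun i => x (Sum.inl i)) (fun i => x (Sum.inr (Sum.inl i)))
      (fun i => x (Sum.inr (Sum.inr i))) = x := by
  ext i; rcases i with i | i | i <;> simp [splitPoint]

theorem norm_toLp_mulVec {ι : Type*} [Fintype ι] [DecidableEq ι] {A : Matrix ι ι ℝ}
    (hA : A ∈ Matrix.orthogonalGroup ι ℝ) (x : ι → ℝ) :
    ‖WithLp.toLp 2 (A.mulVec x)‖ = ‖WithLp.toLp 2 x‖ := by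
  have h : ∀ v : ι → ℝ, ‖WithLp.toLp 2 v‖ ^ 2 = v ⬝ᵥ v := fun v => by
    rw [EuclideanSpace.real_norm_sq_eq]; simp only [dotProduct, sq]
  rw [← sq_eq_sq₀ (norm_nonneg _) (norm_nonneg _), h, h, Matrix.dotProduct_mulVec,
    ← Matrix.mulVec_transpose, Matrix.mulVec_mulVec, (Matrix.mem_orthogonalGroup_iff' _ _).1 hA,
    Matrix.one_mulVec]

theorem exists_linearIsometryEquiv_blockAct {A B : Matrix (Fin m) (Fin m) ℝ}
    (hA : A ∈ Matrix.orthogonalGroup (Fin m) ℝ) (hB : B ∈ Matrix.orthogonalGroup (Fin m) ℝ) :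
    ∃ g : SplitSpace N m ≃ₗᵢ[ℝ] SplitSpace N m, ∀ x, g x = blockAct A B x := by
  let L : SplitSpace N m →ₗ[ℝ] SplitSpace N m :=
    { toFun := blockAct A B
      map_add' := fun x y => by
        ext i; rcases i with i | i | i <;>
          simp [blockAct, splitPoint, Matrix.mulVec, dotProduct, mul_add, Finset.sum_add_distrib]
      map_smul' := fun c x => by
        ext i; rcases i with i | i | i <;>
          simp [blockAct, splitPoint, Matrix.mulVec, dotProduct, Finset.mul_sum, mul_left_comm] }
  have hL : ∀ x, ‖L x‖ = ‖x‖ := by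
    intro x
    rw [← sq_eq_sq₀ (norm_nonneg _) (norm_nonneg _)]
    change ‖blockAct A B x‖ ^ 2 = _
    conv_rhs => rw [← splitPoint_eta x]
    rw [blockAct, norm_splitPoint_sq, norm_splitPoint_sq, norm_toLp_mulVec hA, norm_toLp_mulVec hB]
  exact ⟨(⟨L, hL⟩ : SplitSpace N m →ₗᵢ[ℝ] SplitSpace N m).toLinearIsometryEquiv rfl,
    fun x => rfl⟩

/-- Rotate `x` onto `‖x‖ e_l` for fixed `d`-separated unit vectors `e_l`; the separation becomes at
least `‖x‖ d`, whence `R = r / d`. -/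
theorem exists_separated_orthogonal (hm : 2 ≤ m) (k : ℕ) (r : ℝ) :
    ∃ R : ℝ, ∀ x : Fin m → ℝ, R ≤ ‖WithLp.toLp 2 x‖ →
      ∃ A : Fin k → Matrix (Fin m) (Fin m) ℝ, (∀ l, A l ∈ Matrix.orthogonalGroup (Fin m) ℝ) ∧
        ∀ l l', l ≠ l' → r ≤ ‖WithLp.toLp 2 ((A l).mulVec x - (A l').mulVec x)‖ := by
  obtain ⟨d, hd, e, he, hsep⟩ := exists_separated_unit_vectors hm k
  refine ⟨r / d, fun x hx => ?_⟩
  set ρ := ‖WithLp.toLp 2 x‖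
  have hρ : 0 ≤ ρ := norm_nonneg _
  have : ∀ l, ∃ A ∈ Matrix.orthogonalGroup (Fin m) ℝ,
      A.mulVec (WithLp.toLp 2 x).ofLp = (ρ • e l).ofLp := fun l =>
    exists_orthogonal_mulVec_eq (by rw [norm_smul, he, Real.norm_of_nonneg hρ, mul_one])
  choose A hA hAx using this
  refine ⟨A, hA, fun l l' hl => ?_⟩
  simp only at hAx
  rw [hAx, hAx, ← WithLp.ofLp_sub, WithLp.toLp_ofLp, ← smul_sub, norm_smul,
    Real.norm_of_nonneg hρ, ← dist_eq_norm]
  calc r = r / d * d := by field_simp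
    _ ≤ _ := mul_le_mul hx (hsep l l' hl) hd.le hρ

/-- Move the block that is far from the origin and keep the other fixed. The isometries depend on
`y` but not on `u`, so `R` is uniform over invariant functions. -/
theorem IsO1Invariant.exists_separated_isometries (hm : 2 ≤ m) (k : ℕ) (r : ℝ) :
    ∃ R : ℝ, ∀ y : SplitSpace N m,
      (R ≤ ‖WithLp.toLp 2 fun i => y (Sum.inl i)‖ ∨
        R ≤ ‖WithLp.toLp 2 fun i => y (Sum.inr (Sum.inl i))‖) →
      ∃ g : Fin k → SplitSpace N m ≃ₗᵢ[ℝ] SplitSpace N m,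
        (∀ l l', l ≠ l' → r ≤ dist (g l y) (g l' y)) ∧
        ∀ u : SplitSpace N m → ℝ, IsO1Invariant u → ∀ l, ∀ᵐ x, u (g l x) = u x := by
  obtain ⟨R, hR⟩ := exists_separated_orthogonal hm k r
  refine ⟨R, ?_⟩
  have h1 : (1 : Matrix (Fin m) (Fin m) ℝ) ∈ Matrix.orthogonalGroup (Fin m) ℝ := one_mem _
  rintro y (hy | hy) <;> obtain ⟨A, hA, hsep⟩ := hR _ hy
  · choose g hg using fun l => exists_linearIsometryEquiv_blockAct (N := N) (hA l) h1
    refine ⟨g, fun l l' hl => (hsep l l' hl).trans ?_, fun u hu l => ?_⟩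
    · rw [hg, hg, dist_eq_norm, blockAct, blockAct, splitPoint_sub]
      refine le_of_sq_le_sq ?_ (norm_nonneg _)
      rw [norm_splitPoint_sq]
      exact le_add_of_nonneg_right (by positivity)
    · simpa only [hg] using hu _ (hA l) _ h1
  · choose g hg using fun l => exists_linearIsometryEquiv_blockAct (N := N) h1 (hA l)
    refine ⟨g, fun l l' hl => (hsep l l' hl).trans ?_, fun u hu l => ?_⟩
    · rw [hg, hg, dist_eq_norm, blockAct, blockAct, splitPoint_sub]
      refine le_of_sq_le_sq ?_ (norm_nonneg _)
      rw [norm_splitPoint_sq]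
      exact (le_add_of_nonneg_right (by positivity)).trans (le_add_of_nonneg_left (by positivity))
    · simpa only [hg] using hu _ h1 _ (hA l)

/-- Hölder's inequality on a ball. -/
theorem setLIntegral_sq_le {E : Type*} [MeasurableSpace E] {μ : Measure E} {p : ℝ} (hp : 2 ≤ p)
    {u : E → ℝ} (hu : AEStronglyMeasurable u μ) (s : Set E) :
    ∫⁻ x in s, ‖u x‖ₑ ^ 2 ∂μ ≤
      ((∫⁻ x in s, ‖u x‖ₑ ^ p ∂μ) ^ (1 / p) * μ s ^ (1 / 2 - 1 / p)) ^ 2 := by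
  rw [← eLpNorm_two_sq]
  refine pow_le_pow_left' ?_ 2
  have h := eLpNorm_le_eLpNorm_mul_rpow_measure_univ (μ := μ.restrict s) (p := 2)
    (q := ENNReal.ofReal p) (by simpa using ENNReal.ofReal_le_ofReal hp) hu.restrict
  rw [eLpNorm_eq_lintegral_rpow_enorm_toReal (p := ENNReal.ofReal p) (by simp; linarith) (by simp),
    ENNReal.toReal_ofReal (by linarith), Measure.restrict_apply_univ] at h
  simpa using h

/-- Away from the fixed point set of `O(m) × O(m) × id`, invariant functions bounded in `L^p` are
uniformly small in `L²` on balls of fixed radius. -/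
theorem IsO1Invariant.exists_setLIntegral_le (hm : 2 ≤ m) {p : ℝ} (hp : 2 ≤ p) {M η : ℝ≥0∞}
    (hM : M ≠ ⊤) (hη : 0 < η) (r : ℝ) :
    ∃ R : ℝ, ∀ u : SplitSpace N m → ℝ, IsO1Invariant u → AEStronglyMeasurable u volume →
      ∫⁻ x, ‖u x‖ₑ ^ p ≤ M → ∀ y : SplitSpace N m,
      (R ≤ ‖WithLp.toLp 2 fun i => y (Sum.inl i)‖ ∨
        R ≤ ‖WithLp.toLp 2 fun i => y (Sum.inr (Sum.inl i))‖) →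
      ∫⁻ x in Metric.ball y r, ‖u x‖ₑ ^ 2 ≤ η := by
  have hp0 : 0 < p := by linarith
  set c := volume (Metric.ball (0 : SplitSpace N m) r) ^ (1 / 2 - 1 / p) with hc
  have hcfin : c ≠ ⊤ := by
    refine ENNReal.rpow_ne_top_of_nonneg ?_ measure_ball_lt_top.ne
    rw [sub_nonneg]; exact one_div_le_one_div_of_le (by norm_num) hp
  have hlim : Tendsto (fun k : ℕ => ((M / k) ^ (1 / p) * c) ^ 2) atTop (𝓝 0) := by
    have h1 : Tendsto (fun k : ℕ => M / k) atTop (𝓝 0) := by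
      have := ENNReal.Tendsto.const_div ENNReal.tendsto_nat_nhds_top (a := M) (Or.inr hM)
      simpa using this
    have h2 := ENNReal.Tendsto.mul_const (b := c)
      (h1.ennrpow_const (1 / p)) (Or.inr hcfin)
    rw [ENNReal.zero_rpow_of_pos (by positivity), zero_mul] at h2
    simpa using ENNReal.Tendsto.pow (n := 2) h2
  -- `k` is the number of disjoint copies that brings the Hölder bound for mass `M / k` below `η`.
  obtain ⟨k, hk, hk0⟩ := ((hlim.eventually_le_const hη).and (eventually_gt_atTop 0)).exists
  obtain ⟨R, hR⟩ := IsO1Invariant.exists_separated_isometries (N := N) hm k (2 * r)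
  refine ⟨R, fun u hu hum huM y hy => ?_⟩
  obtain ⟨g, hsep, hg⟩ := hR y hy
  have hk' : ∫⁻ x in Metric.ball y r, ‖u x‖ₑ ^ p ≤ M / k := by
    have := card_mul_setLIntegral_ball_le g (f := fun x => ‖u x‖ₑ ^ p)
      (fun l => (hg u hu l).mono fun x hx => by simp only [hx]) hsep
    rw [Fintype.card_fin] at this
    rw [ENNReal.le_div_iff_mul_le (Or.inl (by simpa using hk0.ne')) (Or.inl (by simp)), mul_comm]
    exact this.trans huM
  refine (setLIntegral_sq_le hp hum _).trans (le_trans ?_ hk)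
  rw [Measure.addHaar_ball_center, ← hc]
  gcongr

/-- Vanishing on balls centred at the fixed point set implies vanishing on all balls. -/
theorem eventually_setLIntegral_ball_le (hm : 2 ≤ m) {p : ℝ} (hp : 2 ≤ p) {M : ℝ≥0∞}
    (hM : M ≠ ⊤) {u : ℕ → SplitSpace N m → ℝ} (hinv : ∀ n, IsO1Invariant (u n))
    (hmeas : ∀ n, AEStronglyMeasurable (u n) volume) (huM : ∀ n, ∫⁻ x, ‖u n x‖ₑ ^ p ≤ M)
    {r₀ : ℝ}
    (hvanish : ∀ r : ℝ, r₀ ≤ r →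
      Tendsto (fun n => ⨆ z : Fin (N - 2 * m) → ℝ,
        ∫⁻ x in Metric.ball (splitPoint 0 0 z : SplitSpace N m) r, ‖u n x‖ₑ ^ 2)
        atTop (𝓝 0)) (r : ℝ) {η : ℝ≥0∞} (hη : 0 < η) :
    ∀ᶠ n in atTop, ∀ y, ∫⁻ x in Metric.ball y r, ‖u n x‖ₑ ^ 2 ≤ η := by
  obtain ⟨R, hR⟩ := IsO1Invariant.exists_setLIntegral_le (N := N) hm hp hM hη r
  -- If both block norms are below `R`, the centre is within `2|R|` of its projection to the fixed
  -- space, so radius `r + 2|R|` suffices; the maximum with `r₀` makes the hypothesis applicable.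
  filter_upwards [(hvanish _ (le_max_left r₀ (r + 2 * |R|))).eventually_le_const hη] with n hn y
  by_cases hy : R ≤ ‖WithLp.toLp 2 fun i => y (Sum.inl i)‖ ∨
        R ≤ ‖WithLp.toLp 2 fun i => y (Sum.inr (Sum.inl i))‖
  · exact hR _ (hinv n) (hmeas n) (huM n) y hy
  · push Not at hy
    refine le_trans ?_ ((le_iSup _ fun i => y (Sum.inr (Sum.inr i))).trans hn)
    refine lintegral_mono_set (Metric.ball_subset_ball' ?_)
    have hd : dist y (splitPoint 0 0 fun i => y (Sum.inr (Sum.inr i))) ≤ 2 * |R| := by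
      have hsub : y - splitPoint 0 0 (fun i => y (Sum.inr (Sum.inr i))) =
          splitPoint (fun i => y (Sum.inl i)) (fun i => y (Sum.inr (Sum.inl i))) 0 := by
        ext i; rcases i with i | i | i <;> simp [splitPoint]
      rw [dist_eq_norm, hsub]
      refine le_of_sq_le_sq ?_ (by positivity)
      rw [norm_splitPoint_sq, WithLp.toLp_zero, norm_zero]
      have h1 := pow_le_pow_left₀ (norm_nonneg _) (hy.1.le.trans (le_abs_self R)) 2
      have h2 := pow_le_pow_left₀ (norm_nonneg _) (hy.2.le.trans (le_abs_self R)) 2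
      nlinarith
    exact le_trans (by linarith) (le_max_right _ _)

end Split

/-! ### Vanishing of the superlevel sets -/

/-- Order of choices: first `δ` with `4δ²D ≤ a²ε`, then `n` large enough for local smallness at
radius `δ`. -/
theorem tendsto_measure_le_enorm {ι : Type*} [Fintype ι] (hN : 3 ≤ Fintype.card ι)
    {u : ℕ → EuclideanSpace ℝ ι → ℝ} {V : ℕ → EuclideanSpace ℝ ι → EuclideanSpace ℝ ι}
    (hu : ∀ n, IsD12Gradient (u n) (V n)) {D : ℝ≥0∞} (hD : D ≠ ⊤)
    (hV : ∀ n, ∫⁻ x, ‖V n x‖ₑ ^ 2 ≤ D)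
    (hsmall : ∀ r : ℝ, ∀ η : ℝ≥0∞, 0 < η →
      ∀ᶠ n in atTop, ∀ y, ∫⁻ x in Metric.ball y r, ‖u n x‖ₑ ^ 2 ≤ η)
    {a : ℝ≥0∞} (ha0 : a ≠ 0) (ha : a ≠ ⊤) :
    Tendsto (fun n => volume {x | a ≤ ‖u n x‖ₑ}) atTop (𝓝 0) := by
  have ha2 : a ^ 2 ≠ 0 := pow_ne_zero 2 ha0
  have ha2' : a ^ 2 ≠ ⊤ := by finiteness
  rw [ENNReal.tendsto_nhds_zero]
  intro ε hε
  have hlim : Tendsto (fun δ : ℝ => 4 * (ENNReal.ofReal δ ^ 2 * D)) (𝓝[>] 0) (𝓝 0) := by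
    have h1 : Tendsto (fun δ : ℝ => ENNReal.ofReal δ ^ 2) (𝓝[>] 0) (𝓝 0) := by
      have := ENNReal.Tendsto.pow (n := 2)
        ((ENNReal.continuous_ofReal.tendsto 0).mono_left (nhdsWithin_le_nhds (s := Set.Ioi 0)))
      simpa using this
    have h2 := ENNReal.Tendsto.const_mul (a := 4)
      (ENNReal.Tendsto.mul_const (b := D) h1 (Or.inr hD)) (Or.inr (by norm_num))
    simpa using h2
  obtain ⟨δ, hδ, hδ0⟩ := ((hlim.eventually_le_const
    (ENNReal.mul_pos ha2 hε.ne')).and self_mem_nhdsWithin).exists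
  have hB := Metric.measure_ball_pos volume (0 : EuclideanSpace ℝ ι) hδ0
  filter_upwards [hsmall δ (a ^ 2 * volume (Metric.ball (0 : EuclideanSpace ℝ ι) δ) / 4)
    (ENNReal.div_pos (mul_ne_zero ha2 hB.ne') (by norm_num))] with n hn
  have h := (hu n).mul_measure_le hN (a := a) (δ := δ)
    (fun x => by
      rw [mul_comm]
      exact (ENNReal.le_div_iff_mul_le (Or.inl (by norm_num)) (Or.inl (by norm_num))).1 (hn x))
    ha hδ0
  rw [← ENNReal.mul_le_mul_iff_right ha2 ha2']
  refine h.trans (le_trans ?_ hδ)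
  gcongr
  exact hV n

/-! ### Subcritical nonlinearities -/

theorem IsSubcritical.apply_zero {N : ℕ} (hN : 3 ≤ N) {Ψ : ℝ → ℝ} (hΨ : Continuous Ψ)
    (hsub : IsSubcritical N Ψ) : Ψ 0 = 0 := by
  have hp : 0 < twoStar N := by linarith [two_lt_twoStar hN]
  have h1 : Tendsto (fun s : ℝ => |s| ^ twoStar N) (𝓝[≠] 0) (𝓝 0) := by
    have : Continuous fun s : ℝ => |s| ^ twoStar N :=
      continuous_abs.rpow_const fun _ => Or.inr hp.le
    simpa [Real.zero_rpow hp.ne'] using (this.tendsto 0).mono_left nhdsWithin_le_nhds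
  have h2 := hsub.1.mul h1
  rw [mul_zero] at h2
  refine tendsto_nhds_unique ((hΨ.tendsto 0).mono_left nhdsWithin_le_nhds) (h2.congr' ?_)
  filter_upwards [self_mem_nhdsWithin] with s hs
  have : |s| ^ twoStar N ≠ 0 := (Real.rpow_pos_of_pos (abs_pos.2 hs) _).ne'
  field_simp

/-- The `ε` term alone dominates near `0` and near infinity; the constant pays for the compact range
between. -/
theorem IsSubcritical.exists_le {N : ℕ} (hN : 3 ≤ N) {Ψ : ℝ → ℝ} (hΨ : Continuous Ψ)
    (hsub : IsSubcritical N Ψ) {ε : ℝ} (hε : 0 < ε) :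
    ∃ a K : ℝ, 0 < a ∧ ∀ s, Ψ s ≤ ε * |s| ^ twoStar N + if a ≤ |s| then K else 0 := by
  have hp : 0 < twoStar N := by linarith [two_lt_twoStar hN]
  have hle : ∀ s : ℝ, s ≠ 0 → Ψ s / |s| ^ twoStar N ≤ ε → Ψ s ≤ ε * |s| ^ twoStar N :=
    fun s hs h => (div_le_iff₀ (Real.rpow_pos_of_pos (abs_pos.2 hs) _)).1 h
  have h0 := hsub.1.eventually_le_const hε
  rw [eventually_nhdsWithin_iff, Metric.eventually_nhds_iff] at h0
  obtain ⟨a, ha, h0⟩ := h0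
  have hinf := hsub.2.eventually_le_const hε
  rw [eventually_comap, eventually_atTop] at hinf
  obtain ⟨b, hb⟩ := hinf
  obtain ⟨K, hK⟩ := (isCompact_Icc (a := -b) (b := b)).bddAbove_image hΨ.continuousOn
  -- The constant must be nonnegative to be harmless where `|s| ≥ b`, and `K` need not be.
  refine ⟨a, max K 0, ha, fun s => ?_⟩
  have hnn : 0 ≤ ε * |s| ^ twoStar N := by positivity
  split_ifs with hs
  · rcases le_total b |s| with hbs | hbs
    · have := hle s (abs_pos.1 (ha.trans_le hs)) (hb _ hbs s rfl)
      linarith [le_max_right K 0]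
    · have := hK ⟨s, abs_le.1 hbs, rfl⟩
      linarith [le_max_left K 0]
  · rw [add_zero]
    rcases eq_or_ne s 0 with rfl | hs0
    · rwa [hsub.apply_zero hN hΨ]
    · exact hle s hs0 (h0 (by simpa using hs) hs0)

theorem lintegral_ofReal_comp_le {α : Type*} [MeasurableSpace α] {μ : Measure α} {N : ℕ}
    {Ψ : ℝ → ℝ} {ε a K : ℝ} (hε : 0 ≤ ε) (hp : 0 ≤ twoStar N)
    (h : ∀ s, Ψ s ≤ ε * |s| ^ twoStar N + if a ≤ |s| then K else 0)
    {u : α → ℝ} (hu : AEStronglyMeasurable u μ) :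
    ∫⁻ x, ENNReal.ofReal (Ψ (u x)) ∂μ ≤ ENNReal.ofReal ε * ∫⁻ x, ‖u x‖ₑ ^ twoStar N ∂μ +
      ENNReal.ofReal K * μ {x | ENNReal.ofReal a ≤ ‖u x‖ₑ} := by
  have hs : NullMeasurableSet {x | ENNReal.ofReal a ≤ ‖u x‖ₑ} μ :=
    nullMeasurableSet_le aemeasurable_const hu.enorm
  rw [← lintegral_const_mul' _ _ (by finiteness), ← lintegral_indicator_const₀ hs,
    ← lintegral_add_left' ((hu.enorm.pow_const _).const_mul _)]
  refine lintegral_mono fun x => (ENNReal.ofReal_le_ofReal (h (u x))).trans ?_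
  refine ENNReal.ofReal_add_le.trans (add_le_add (le_of_eq ?_) ?_)
  · rw [ENNReal.ofReal_mul hε, ← ENNReal.ofReal_rpow_of_nonneg (abs_nonneg _) hp,
      ← Real.norm_eq_abs, ofReal_norm]
  · split_ifs with hx
    · have : x ∈ {x | ENNReal.ofReal a ≤ ‖u x‖ₑ} := by
        rw [Set.mem_ofPred_eq, ← ofReal_norm]
        exact ENNReal.ofReal_le_ofReal hx
      rw [Set.indicator_of_mem this]
    · simp

/-- The splitting with `ε = 1`, the superlevel set having finite measure by Chebyshev's inequality.
-/
theorem IsSubcritical.lintegral_lt_top {α : Type*} [MeasurableSpace α] {μ : Measure α} {N : ℕ}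
    (hN : 3 ≤ N) {Ψ : ℝ → ℝ} (hΨ : Continuous Ψ) (hsub : IsSubcritical N Ψ)
    {u : α → ℝ} (hu : AEStronglyMeasurable u μ) (hfin : ∫⁻ x, ‖u x‖ₑ ^ twoStar N ∂μ ≠ ⊤) :
    ∫⁻ x, ENNReal.ofReal (Ψ (u x)) ∂μ < ⊤ := by
  have hp : 0 < twoStar N := by linarith [two_lt_twoStar hN]
  obtain ⟨a, K, ha, h⟩ := hsub.exists_le hN hΨ one_pos
  refine (lintegral_ofReal_comp_le zero_le_one hp.le h hu).trans_lt ?_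
  have hset : μ {x | ENNReal.ofReal a ≤ ‖u x‖ₑ} ≠ ⊤ := by
    refine ne_top_of_le_ne_top ?_ (measure_mono (t := {x | ENNReal.ofReal a ^ twoStar N ≤
      ‖u x‖ₑ ^ twoStar N}) fun x hx => ENNReal.rpow_le_rpow hx hp.le)
    refine ne_top_of_le_ne_top ?_ (meas_ge_le_lintegral_div (hu.enorm.pow_const _) ?_ ?_)
    · exact ENNReal.div_ne_top hfin
        (ENNReal.rpow_pos (ENNReal.ofReal_pos.2 ha) ENNReal.ofReal_ne_top).ne'
    · exact (ENNReal.rpow_pos (ENNReal.ofReal_pos.2 ha) ENNReal.ofReal_ne_top).ne'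
    · exact ENNReal.rpow_ne_top_of_nonneg hp.le ENNReal.ofReal_ne_top
  finiteness

theorem IsSubcritical.tendsto_lintegral {α : Type*} [MeasurableSpace α] {μ : Measure α} {N : ℕ}
    (hN : 3 ≤ N) {Ψ : ℝ → ℝ} (hΨ : Continuous Ψ) (hsub : IsSubcritical N Ψ)
    {u : ℕ → α → ℝ} (hu : ∀ n, AEStronglyMeasurable (u n) μ) {M : ℝ≥0∞} (hM : M ≠ ⊤)
    (huM : ∀ n, ∫⁻ x, ‖u n x‖ₑ ^ twoStar N ∂μ ≤ M)
    (hlevel : ∀ a : ℝ≥0∞, a ≠ 0 → a ≠ ⊤ → Tendsto (fun n => μ {x | a ≤ ‖u n x‖ₑ}) atTop (𝓝 0)) :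
    Tendsto (fun n => ∫⁻ x, ENNReal.ofReal (Ψ (u n x)) ∂μ) atTop (𝓝 0) := by
  have hp : 0 < twoStar N := by linarith [two_lt_twoStar hN]
  rw [ENNReal.tendsto_nhds_zero]
  intro η hη
  have hη2 : 0 < η / 2 := ENNReal.half_pos hη.ne'
  have hlim : Tendsto (fun ε : ℝ => ENNReal.ofReal ε * M) (𝓝[>] 0) (𝓝 0) := by
    have := ENNReal.Tendsto.mul_const (b := M)
      ((ENNReal.continuous_ofReal.tendsto 0).mono_left (nhdsWithin_le_nhds (s := Set.Ioi 0)))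
      (Or.inr hM)
    simpa using this
  obtain ⟨ε, hεM, hε⟩ := ((hlim.eventually_le_const hη2).and self_mem_nhdsWithin).exists
  obtain ⟨a, K, ha, h⟩ := hsub.exists_le hN hΨ hε
  have h2 := ENNReal.Tendsto.const_mul (a := ENNReal.ofReal K)
    (hlevel _ (ENNReal.ofReal_pos.2 ha).ne' ENNReal.ofReal_ne_top) (Or.inr ENNReal.ofReal_ne_top)
  rw [mul_zero] at h2
  filter_upwards [h2.eventually_le_const hη2] with n hn
  refine (lintegral_ofReal_comp_le (le_of_lt hε) hp.le h (hu n)).trans ?_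
  rw [← ENNReal.add_halves η]
  exact add_le_add ((mul_le_mul_right (huM n) _).trans hεM) hn

/-! ### The chosen gradient and the main theorem -/

theorem MemD12.isD12Gradient {ι : Type*} [Fintype ι] {u : EuclideanSpace ℝ ι → ℝ}
    (hu : MemD12 u) : IsD12Gradient u (d12Gradient u) := by
  rw [d12Gradient, dif_pos hu]
  exact hu.choose_spec

theorem MemD12.eLpNorm_d12Gradient {ι : Type*} [Fintype ι] {u : EuclideanSpace ℝ ι → ℝ}
    (hu : MemD12 u) : eLpNorm (d12Gradient u) 2 volume = ENNReal.ofReal (d12Norm u) := by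
  have hV := hu.isD12Gradient.2.1
  rw [d12Norm, hV.eLpNorm_eq_integral_rpow_norm (by norm_num) (by norm_num), Real.sqrt_eq_rpow]
  norm_num

theorem corollary2p2 (N m : ℕ) (hm : 2 ≤ m) (hmN : 2 * m ≤ N)
    (u : ℕ → SplitSpace N m → ℝ)
    (hu : ∀ n, MemD12 (u n))
    (hinv : ∀ n, IsO1Invariant (u n))
    (hbdd : ∃ C : ℝ, ∀ n, d12Norm (u n) ≤ C)
    (r₀ : ℝ) (hr₀ : 0 < r₀)
    (hvanish : ∀ r : ℝ, r₀ ≤ r →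
      Tendsto (fun n => ⨆ z : Fin (N - 2 * m) → ℝ,
        ∫⁻ x in Metric.ball (splitPoint 0 0 z : SplitSpace N m) r, ‖u n x‖ₑ ^ 2)
        atTop (𝓝 0)) :
    ∀ Ψ : ℝ → ℝ, Continuous Ψ → (∀ s, 0 ≤ Ψ s) → IsSubcritical N Ψ →
      (∀ n, Integrable (fun x => Ψ (u n x)) volume) ∧
      Tendsto (fun n => ∫ x, Ψ (u n x)) atTop (𝓝 0) := by
  intro Ψ hΨ hΨ0 hsub
  obtain ⟨C, hC⟩ := hbdd
  have hN : 3 ≤ N := by omega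
  have hcard : Fintype.card (Fin m ⊕ Fin m ⊕ Fin (N - 2 * m)) = N := by simp; omega
  have hcard3 : 3 ≤ Fintype.card (Fin m ⊕ Fin m ⊕ Fin (N - 2 * m)) := by omega
  have hp : 2 < twoStar N := two_lt_twoStar hN
  have hgrad := fun n => (hu n).isD12Gradient
  have hmeas : ∀ n, AEStronglyMeasurable (u n) volume := fun n => (hgrad n).1.aestronglyMeasurable
  have hV : ∀ n, eLpNorm (d12Gradient (u n)) 2 volume ≤ ENNReal.ofReal C := fun n => by
    rw [(hu n).eLpNorm_d12Gradient]
    exact ENNReal.ofReal_le_ofReal (hC n)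
  obtain ⟨S, hS⟩ := exists_sobolev_const (Fin m ⊕ Fin m ⊕ Fin (N - 2 * m)) hcard3
  rw [hcard] at hS
  have huM : ∀ n, ∫⁻ x, ‖u n x‖ₑ ^ twoStar N ≤ (S * ENNReal.ofReal C) ^ twoStar N := by
    intro n
    have h := (hS _ _ (hgrad n)).trans (mul_le_mul_right (hV n) _)
    rw [eLpNorm_eq_lintegral_rpow_enorm_toReal (by simp; linarith) (by simp),
      ENNReal.toReal_ofReal (by linarith), one_div, ENNReal.rpow_inv_le_iff (by linarith)] at h
    exact h
  have hM : ((S : ℝ≥0∞) * ENNReal.ofReal C) ^ twoStar N ≠ ⊤ :=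
    ENNReal.rpow_ne_top_of_nonneg (by linarith) (by finiteness)
  have hlevel : ∀ a : ℝ≥0∞, a ≠ 0 → a ≠ ⊤ →
      Tendsto (fun n => volume {x | a ≤ ‖u n x‖ₑ}) atTop (𝓝 0) := fun a ha0 ha =>
    tendsto_measure_le_enorm hcard3 hgrad (D := ENNReal.ofReal C ^ 2) (by finiteness)
      (fun n => by rw [← eLpNorm_two_sq]; exact pow_le_pow_left' (hV n) 2)
      (fun r η hη => eventually_setLIntegral_ball_le hm hp.le hM hinv hmeas huM hvanish r hη)
      ha0 ha
  have hlim := hsub.tendsto_lintegral hN hΨ hmeas hM huM hlevel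
  have hΨmeas : ∀ n, AEStronglyMeasurable (fun x => Ψ (u n x)) volume := fun n =>
    hΨ.comp_aestronglyMeasurable (hmeas n)
  refine ⟨fun n => ⟨hΨmeas n, ?_⟩, ?_⟩
  · rw [hasFiniteIntegral_iff_ofReal (ae_of_all _ fun x => hΨ0 _)]
    exact hsub.lintegral_lt_top hN hΨ (hmeas n) (ne_top_of_le_ne_top hM (huM n))
  · simp_rw [fun n => integral_eq_lintegral_of_nonneg_ae (μ := volume)
      (ae_of_all _ fun x => hΨ0 (u n x)) (hΨmeas n)]
    exact (ENNReal.tendsto_toReal ENNReal.zero_ne_top).comp hlim
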